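/- **Theorem (hardness for the Jaillet–Lu LP).** Consider unweighted online stochastic matching in the Poisson arrival model: there are finite sets $I$ of online types and $J$ of offline vertices, each type $i\in I$ has an arrival rate $\lambda_i>0$ and a set $J_i\subseteq J$ of adjacent offline vertices, and, independently over $i\in I$, online vertices of type $i$ arrive according to a Poisson process of rate $\lambda_i$ during the time interval $[0,1]$. When an online vertex arrives, a (possibly randomized) online algorithm, which knows the instance and the types and times of the arrivals so far but not the future, immediately and irrevocably matches it to an adjacent offline vertex or leaves it unmatched; each offline vertex can be matched at most once. Let $\mathrm{ALG}$ be the expected size of the resulting matching. With $I_j=\{i\in I: j\in J_i\}$, let $\mathrm{JL}$ be the optimal value of the Jaillet–Lu linear program $$\max\ \sum_{i\in I}\sum_{j\in J_i}x_{ij}\quad\text{s.t.}\quad \sum_{j\in J_i}x_{ij}\le\lambda_i\ (i\in I),\quad \sum_{i\in I_j}x_{ij}\le 1\ (j\in J),\quad \sum_{i\in I_j}\max\{2x_{ij}-\lambda_i,0\}\le 1-\ln 2\ (j\in J),\quad x_{ij}\ge 0\ (i\in I,\ j\in J_i).$$ There is an instance with three online types and two offline vertices, with $\mathrm{JL}>0$,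 on which every online algorithm satisfies $$\frac{\mathrm{ALG}}{\mathrm{JL}}\le 1-\frac{1}{1-\ln 2}\Big(\frac{1}{2e}-\frac{\ln 2}{e^2}\Big)\approx 0.706,$$ where $\approx$ means that the two numbers differ by less than $0.0005$. -/

import Mathlib

open MeasureTheory ProbabilityTheory Finset

noncomputable section

namespace StochasticMatching

/-- An instance of unweighted online stochastic matching with online types `I` and offline vertices
`J`: every online type `i` has an arrival rate `rate i` and a set `nbr i` of adjacent offline
vertices. Every edge has weight one. -/
structure MatchingInstance (I J : Type*) where
  /-- arrival rate of each online type -/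
  rate : I → ℝ
  rate_pos : ∀ i, 0 < rate i
  /-- offline vertices adjacent to online vertices of a given type -/
  nbr : I → Finset J

variable {I J : Type*}

namespace MatchingInstance

/-- The feasible solutions of the Jaillet–Lu linear program of `G`. Only the values `x i j` with
`j ∈ G.nbr i` matter. -/
structure IsJLFeasible [Fintype I] [Fintype J] [DecidableEq J] (G : MatchingInstance I J)
    (x : I → J → ℝ) : Prop where
  nonneg : ∀ i, ∀ j ∈ G.nbr i, 0 ≤ x i j
  online : ∀ i, ∑ j ∈ G.nbr i, x i j ≤ G.rate i
  offline : ∀ j, ∑ i with j ∈ G.nbr i, x i j ≤ 1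
  half : ∀ j, ∑ i with j ∈ G.nbr i, max (2 * x i j - G.rate i) 0 ≤ 1 - Real.log 2

/-- The set of objective values of the feasible solutions of the Jaillet–Lu linear program. -/
def jlValues [Fintype I] [Fintype J] [DecidableEq J] (G : MatchingInstance I J) : Set ℝ :=
  {v | ∃ x : I → J → ℝ, G.IsJLFeasible x ∧ v = ∑ i, ∑ j ∈ G.nbr i, x i j}

/-- The law of the waiting times in the Poisson arrival model: the entry at `(i, k)` is the time
between the `k`-th arrival of type `i` (time `0` if `k = 0`) and the next arrival of type `i`.
All of them are independent, and those of type `i` are exponential with rate `G.rate i`, that is,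
the types arrive according to independent Poisson processes with rates `G.rate i`. -/
def gapLaw (G : MatchingInstance I J) : Measure (I × ℕ → ℝ) :=
  Measure.infinitePi fun p : I × ℕ => expMeasure (G.rate p.1)

end MatchingInstance

/-- The time of the arrival number `k` (counted from `0`) of type `i`, given all waiting times.
The arrival takes place within the time horizon if this is at most `1`. -/
def arrivalTime (g : I × ℕ → ℝ) (i : I) (k : ℕ) : ℝ :=
  ∑ m ∈ range (k + 1), g (i, m)

/-- What has been observed of the arrivals up to and including time `s`: all arrival times of all
types that are at most `s`. All later arrivals are masked by the value `⊤`. -/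
def history (g : I × ℕ → ℝ) (s : ℝ) : I → ℕ → EReal := fun i k =>
  if arrivalTime g i k ≤ s then (arrivalTime g i k : EReal) else ⊤

/-- A randomized online algorithm with random seed in `Ω`. When an online vertex of type `i`
arrives at time `s` and `h` is the history of arrivals up to time `s`, the algorithm assigns the
vertex to the offline vertex `decide r i s h`, or leaves it unmatched if this is `none`, where `r`
is the seed. (Its own earlier decisions are functions of the seed and of the history.) -/
structure OnlineAlgorithm (I J Ω : Type*) [MeasurableSpace Ω] where
  /-- the irrevocable decision for the arriving online vertex -/
  decide : Ω → I → ℝ → (I → ℕ → EReal) → Option J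
  measurable_decide : ∀ i j,
    MeasurableSet {p : Ω × ℝ × (I → ℕ → EReal) | decide p.1 i p.2.1 p.2.2 = some j}

namespace OnlineAlgorithm

variable {Ω : Type*} [MeasurableSpace Ω]

/-- The set of offline vertices that are matched at the end of the time horizon: those to which the
algorithm has assigned some adjacent online vertex that arrived by time `1`. An offline vertex is
matched to the first such online vertex; assigning further ones to it gains nothing. Hence the
number of elements is the size of the matching. -/
def matched (A : OnlineAlgorithm I J Ω) (G : MatchingInstance I J) (r : Ω) (g : I × ℕ → ℝ) :
    Set J :=
  {j | ∃ (i : I) (k : ℕ), arrivalTime g i k ≤ 1 ∧ j ∈ G.nbr i ∧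
    A.decide r i (arrivalTime g i k) (history g (arrivalTime g i k)) = some j}

/-- The expected size of the matching of the algorithm `A` on the instance `G` in the Poisson
arrival model. The seed has law `ρ` and is independent of the arrivals. -/
def expectedSize (A : OnlineAlgorithm I J Ω) (G : MatchingInstance I J) (ρ : Measure Ω) : ℝ :=
  ∫ w : Ω × (I × ℕ → ℝ), ((A.matched G w.1 w.2).ncard : ℝ) ∂(ρ.prod G.gapLaw)

end OnlineAlgorithm

/-- The ratio `1 - (1 / (1 - ln 2)) (1 / (2e) - ln 2 / e²)`. -/
def hardnessRatio : ℝ :=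
  1 - 1 / (1 - Real.log 2) * (1 / (2 * Real.exp 1) - Real.log 2 / Real.exp 1 ^ 2)

end StochasticMatching

end

/-! Whatever an algorithm does, the first arrival uses up at most one of the two offline vertices,
so some vertex `u` is spared. If that arrival occurs at time `t ≤ 1` and no type adjacent to `u`
arrives in `(t, 1]`, then `u` stays unmatched. The loss from perfect size 2 is thus at least 2
without any arrival, and at least 1 on this event (`ncard_matched_le`). In `hardInstance` the total
rate is `2`, and each offline vertex sees adjacent rate `1 + ln 2`. The probability that a vertex is
lost this way therefore does not depend on which one is spared: it is `∫₀¹ 2 e^(-2t) e^(-(1 + ln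
2)(1 - t)) dt = 2 (1/(2e) - e⁻²)/(1 - ln 2)`. Together with the loss `2 e⁻²` from no arrival this
bounds every algorithm by `2 * hardnessRatio`, whereas the linear program has value `2`. -/

noncomputable section

namespace StochasticMatching

/-! ### Distribution of the waiting times. -/

section GapLaw

variable {I J : Type*}

lemma expMeasure_Ioi {r x : ℝ} (hr : 0 < r) (hx : 0 ≤ x) :
    expMeasure r (Set.Ioi x) = ENNReal.ofReal (Real.exp (-(r * x))) := by
  have := isProbabilityMeasure_expMeasure hr
  have h := cdf_expMeasure_eq hr x
  rw [if_pos hx, cdf_eq_real] at h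
  rw [← ofReal_measureReal, ← Set.compl_Iic, probReal_compl_eq_one_sub measurableSet_Iic, h]
  congr 1
  ring

lemma setLIntegral_expMeasure {r : ℝ} {S : Set ℝ} (hS : MeasurableSet S)
    (hS0 : S ⊆ Set.Ici 0) {f : ℝ → ENNReal} (hf : Measurable f) :
    ∫⁻ t in S, f t ∂expMeasure r =
      ∫⁻ t in S, ENNReal.ofReal (r * Real.exp (-(r * t))) * f t := by
  have hm : Measurable (exponentialPDF r) := (measurable_exponentialPDFReal r).ennreal_ofReal
  change ∫⁻ t in S, f t ∂(volume.withDensity (exponentialPDF r)) = _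
  rw [restrict_withDensity hS, lintegral_withDensity_eq_lintegral_mul _ hm hf]
  refine setLIntegral_congr_fun hS fun t ht => ?_
  rw [Pi.mul_apply, exponentialPDF_of_nonneg (hS0 ht)]

namespace MatchingInstance

variable (G : MatchingInstance I J)

instance (i : I) : IsProbabilityMeasure (expMeasure (G.rate i)) :=
  isProbabilityMeasure_expMeasure (G.rate_pos i)

instance : IsProbabilityMeasure G.gapLaw := by
  unfold gapLaw
  infer_instance

lemma ae_gap_pos [Countable I] : ∀ᵐ g ∂G.gapLaw, ∀ q, 0 < g q := by
  rw [ae_all_iff]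
  intro q
  have h : ∀ᵐ t ∂expMeasure (G.rate q.1), 0 < t := by
    change expMeasure (G.rate q.1) (Set.Ioi 0)ᶜ = 0
    rw [prob_compl_eq_zero_iff measurableSet_Ioi, expMeasure_Ioi (G.rate_pos _) le_rfl]
    simp
  exact (measurePreserving_eval_infinitePi
    (fun p : I × ℕ => expMeasure (G.rate p.1)) q).quasiMeasurePreserving.ae h

lemma gapLaw_forall_lt (T : Finset (I × ℕ)) {θ : I × ℕ → ℝ} (hθ : ∀ q ∈ T, 0 ≤ θ q) :
    G.gapLaw {g | ∀ q ∈ T, θ q < g q} =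
      ENNReal.ofReal (Real.exp (-∑ q ∈ T, G.rate q.1 * θ q)) := by
  have : {g : I × ℕ → ℝ | ∀ q ∈ T, θ q < g q} = Set.pi T fun q => Set.Ioi (θ q) := by
    ext g
    simp [Set.mem_pi]
  rw [this, gapLaw, Measure.infinitePi_pi _ fun _ _ => measurableSet_Ioi,
    ← sum_neg_distrib, Real.exp_sum,
    ENNReal.ofReal_prod_of_nonneg fun _ _ => (Real.exp_pos _).le]
  exact prod_congr rfl fun q hq => expMeasure_Ioi (G.rate_pos _) (hθ q hq)

/-- Conditioning on the gap `p`, which is independent of the gaps in `T`. The thresholds may depend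
on the value of `p` because the spared vertex depends on the time of the first arrival. -/
lemma gapLaw_mem_and_forall_lt {p : I × ℕ} {T : Finset (I × ℕ)} (hp : p ∉ T) {S : Set ℝ}
    (hS : MeasurableSet S) (hS0 : S ⊆ Set.Ici 0) {θ : I × ℕ → ℝ → ℝ}
    (hθm : ∀ q, Measurable (θ q)) (hθ : ∀ q, ∀ t ∈ S, 0 ≤ θ q t) :
    G.gapLaw {g | g p ∈ S ∧ ∀ q ∈ T, θ q (g p) < g q} =
      ∫⁻ t in S, ENNReal.ofReal (G.rate p.1 *
        Real.exp (-(G.rate p.1 * t + ∑ q ∈ T, G.rate q.1 * θ q t))) := by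
  have hind : IndepFun (fun g : I × ℕ → ℝ => g p) T.restrict G.gapLaw := by
    have h := (iIndepFun_infinitePi (P := fun p : I × ℕ => expMeasure (G.rate p.1))
      (X := fun _ x => x) fun _ => measurable_id).indepFun_finset {p} T
      (by simpa using hp) fun q => measurable_pi_apply q
    exact h.comp (φ := fun x : ({p} : Finset (I × ℕ)) → ℝ => x ⟨p, mem_singleton_self p⟩)
      (ψ := id) (measurable_pi_apply _) measurable_id
  set A : Set (ℝ × (T → ℝ)) := {z | z.1 ∈ S ∧ ∀ q : T, θ q z.1 < z.2 q} with hA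
  have hAm : MeasurableSet A := by
    have h : MeasurableSet {z : ℝ × (T → ℝ) | ∀ q : T, θ q z.1 < z.2 q} := by
      rw [Set.ofPred_forall]
      exact MeasurableSet.iInter fun q => measurableSet_lt ((hθm q).comp measurable_fst)
        ((measurable_pi_apply q).comp measurable_snd)
    exact (measurable_fst hS).inter h
  have hsec : ∀ t, G.gapLaw.map T.restrict (Prod.mk t ⁻¹' A) =
      S.indicator (fun t => ENNReal.ofReal (Real.exp (-∑ q ∈ T, G.rate q.1 * θ q t))) t := by
    intro t
    rw [Measure.map_apply (measurable_restrict T) (measurable_prodMk_left hAm)]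
    by_cases ht : t ∈ S
    · rw [Set.indicator_of_mem ht, ← G.gapLaw_forall_lt T fun q _ => hθ q t ht]
      congr 1
      ext g
      simp [hA, ht]
    · rw [Set.indicator_of_notMem ht]
      convert measure_empty (μ := G.gapLaw)
      ext g
      simp [hA, ht]
  have hlaw : G.gapLaw.map (fun g => g p) = expMeasure (G.rate p.1) :=
    Measure.infinitePi_map_eval (fun p : I × ℕ => expMeasure (G.rate p.1)) p
  have hpre : {g : I × ℕ → ℝ | g p ∈ S ∧ ∀ q ∈ T, θ q (g p) < g q} =
      (fun g => (g p, T.restrict g)) ⁻¹' A := by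
    ext g
    simp [hA]
  rw [hpre, ← Measure.map_apply ((measurable_pi_apply p).prodMk (measurable_restrict T)) hAm,
    (indepFun_iff_map_prod_eq_prod_map_map (measurable_pi_apply p).aemeasurable
      (measurable_restrict T).aemeasurable).1 hind,
    Measure.prod_apply hAm, lintegral_congr hsec, hlaw, lintegral_indicator hS,
    setLIntegral_expMeasure hS hS0 (by fun_prop)]
  refine lintegral_congr fun t => ?_
  rw [← ENNReal.ofReal_mul' (Real.exp_pos _).le, mul_assoc, ← Real.exp_add, neg_add]

end MatchingInstance

end GapLaw

/-! ### Pathwise analysis of the first arrival. -/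

section PathBound

variable {I J Ω : Type*} [MeasurableSpace Ω]

lemma arrivalTime_zero (g : I × ℕ → ℝ) (i : I) : arrivalTime g i 0 = g (i, 0) := by
  simp [arrivalTime]

lemma arrivalTime_mono {g : I × ℕ → ℝ} (hg : ∀ q, 0 < g q) (i : I) :
    Monotone (arrivalTime g i) := fun _ _ h =>
  sum_le_sum_of_subset_of_nonneg (range_subset_range.2 (by omega)) fun q _ _ => (hg (i, q)).le

/-- The event that there is no arrival by time `1`. -/
def noArrival (I Ω : Type*) : Set (Ω × (I × ℕ → ℝ)) :=
  {w | ∀ i, 1 < w.2 (i, 0)}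

lemma measurableSet_noArrival [Countable I] : MeasurableSet (noArrival I Ω) := by
  unfold noArrival
  rw [Set.ofPred_forall]
  exact MeasurableSet.iInter fun i => measurableSet_lt measurable_const (by fun_prop)

lemma OnlineAlgorithm.matched_eq_empty (A : OnlineAlgorithm I J Ω) (G : MatchingInstance I J) (r : Ω)
    {g : I × ℕ → ℝ} (hg : ∀ q, 0 < g q) (h : ∀ i, 1 < g (i, 0)) : A.matched G r g = ∅ := by
  refine Set.eq_empty_of_forall_notMem ?_
  rintro j ⟨i, k, hk, -⟩
  have h1 := arrivalTime_mono hg i k.zero_le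
  rw [arrivalTime_zero] at h1
  linarith [h i]

variable [DecidableEq I] [DecidableEq J]

/-- What has been observed at time `t` if the first arrival of all takes place at time `t` and is of
type `i`. -/
def firstHistory (i : I) (t : ℝ) : I → ℕ → EReal := fun i' k =>
  if i' = i ∧ k = 0 then (t : EReal) else ⊤

lemma measurable_firstHistory (i : I) : Measurable (firstHistory i) := by
  refine measurable_pi_iff.2 fun i' => measurable_pi_iff.2 fun k => ?_
  unfold firstHistory
  split_ifs
  · exact measurable_coe_real_ereal
  · exact measurable_const

/-- At the first arrival of all, the decision can depend only on the seed, the type and the time;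
this is what makes the spared vertex independent of the later gaps. -/
lemma history_eq_firstHistory {g : I × ℕ → ℝ} (hg : ∀ q, 0 < g q) {i : I}
    (h : ∀ i', i' ≠ i → g (i, 0) < g (i', 0)) :
    history g (g (i, 0)) = firstHistory i (g (i, 0)) := by
  funext i' k
  unfold history firstHistory
  by_cases hi : i' = i
  · subst hi
    rcases Nat.eq_zero_or_pos k with rfl | hk
    · simp [arrivalTime_zero]
    · have h1 : arrivalTime g i' 1 ≤ arrivalTime g i' k := arrivalTime_mono hg i' hk
      have h2 : arrivalTime g i' 1 = g (i', 0) + g (i', 1) := by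
        simp [arrivalTime, sum_range_succ]
      have h3 := hg (i', 1)
      rw [if_neg (by linarith), if_neg (by omega)]
  · have h1 : arrivalTime g i' 0 ≤ arrivalTime g i' k := arrivalTime_mono hg i' k.zero_le
    rw [arrivalTime_zero] at h1
    have h2 := h i' hi
    rw [if_neg (by linarith), if_neg (by tauto)]

/-- If the first arrival is of type `i` and takes place at time `t`, then the gap `q` exceeds this
value if and only if the next arrival of type `q.1` is later than `t`, and also later than `1` in
case that type is adjacent to `u`. -/
def gapThreshold (G : MatchingInstance I J) (u : J) (i : I) (q : I × ℕ) (t : ℝ) : ℝ :=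
  (if u ∈ G.nbr q.1 then 1 else t) - if q.1 = i then t else 0

/-- The first gaps of all other types and the second gap of type `i`. -/
def otherGaps [Fintype I] (i : I) : Finset (I × ℕ) :=
  insert (i, 1) ((univ.erase i).image fun i' => (i', 0))

lemma mem_otherGaps_of_ne [Fintype I] {i i' : I} (h : i' ≠ i) : (i', 0) ∈ otherGaps i := by
  simp [otherGaps, h]

lemma lt_of_gapThreshold_lt {G : MatchingInstance I J} {u : J} {i i' : I} (h : i' ≠ i)
    {g : I × ℕ → ℝ} (h1 : g (i, 0) ≤ 1)
    (hlt : gapThreshold G u i (i', 0) (g (i, 0)) < g (i', 0)) : g (i, 0) < g (i', 0) := by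
  simp only [gapThreshold, h, if_false, sub_zero] at hlt
  split_ifs at hlt <;> linarith

namespace OnlineAlgorithm

lemma notMem_matched [Fintype I] (A : OnlineAlgorithm I J Ω) (G : MatchingInstance I J) (r : Ω)
    {g : I × ℕ → ℝ} (hg : ∀ q, 0 < g q) {i : I} {u : J} (h1 : g (i, 0) ≤ 1)
    (hgap : ∀ q ∈ otherGaps i, gapThreshold G u i q (g (i, 0)) < g q)
    (hdec : A.decide r i (g (i, 0)) (firstHistory i (g (i, 0))) ≠ some u) :
    u ∉ A.matched G r g := by
  rintro ⟨i', k, hk, hadj, hd⟩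
  by_cases hi : i' = i
  · subst hi
    rcases Nat.eq_zero_or_pos k with rfl | hk0
    · rw [arrivalTime_zero, history_eq_firstHistory hg fun i hi =>
        lt_of_gapThreshold_lt hi h1 (hgap _ (mem_otherGaps_of_ne hi))] at hd
      exact hdec hd
    -- A later arrival of the same type is no earlier than the sum of the first two gaps, and the
    -- second gap exceeds `1 - g (i', 0)`.
    · have h2 : arrivalTime g i' 1 ≤ arrivalTime g i' k := arrivalTime_mono hg i' hk0
      have h3 : arrivalTime g i' 1 = g (i', 0) + g (i', 1) := by
        simp [arrivalTime, sum_range_succ]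
      have h4 := hgap (i', 1) (by simp [otherGaps])
      simp only [gapThreshold, hadj, if_true] at h4
      linarith
  · have h2 := arrivalTime_mono hg i' k.zero_le
    rw [arrivalTime_zero] at h2
    have h3 := hgap _ (mem_otherGaps_of_ne hi)
    simp only [gapThreshold, hadj, hi, if_true, if_false] at h3
    linarith

end OnlineAlgorithm

end PathBound

/-! ### Bounding the expected size with two offline vertices. -/

section TwoOfflineVertices

variable {I Ω : Type*} [MeasurableSpace Ω] [DecidableEq I]

namespace OnlineAlgorithm

/-- An offline vertex that is not matched to the first arrival of all if that is of type `i` and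
takes place at time `t`. -/
def spared (A : OnlineAlgorithm I (Fin 2) Ω) (i : I) (z : Ω × ℝ) : Fin 2 :=
  open Classical in if A.decide z.1 i z.2 (firstHistory i z.2) = some 0 then 1 else 0

lemma measurable_spared (A : OnlineAlgorithm I (Fin 2) Ω) (i : I) : Measurable (A.spared i) := by
  classical
  refine Measurable.ite ?_ measurable_const measurable_const
  exact (measurable_fst.prodMk (measurable_snd.prodMk
    ((measurable_firstHistory i).comp measurable_snd))) (A.measurable_decide i 0)

lemma decide_ne_spared (A : OnlineAlgorithm I (Fin 2) Ω) (i : I) (r : Ω) (t : ℝ) :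
    A.decide r i t (firstHistory i t) ≠ some (A.spared i (r, t)) := by
  unfold spared
  split_ifs with h
  · simp [h]
  · exact h

/-- The event that the first arrival of all is of type `i`, takes place by time `1`, and is followed
by no arrival of a type adjacent to the spared vertex. -/
def spareEvent [Fintype I] (A : OnlineAlgorithm I (Fin 2) Ω) (G : MatchingInstance I (Fin 2))
    (i : I) : Set (Ω × (I × ℕ → ℝ)) :=
  {w | w.2 (i, 0) ∈ Set.Icc 0 1 ∧ ∀ q ∈ otherGaps i,
    gapThreshold G (A.spared i (w.1, w.2 (i, 0))) i q (w.2 (i, 0)) < w.2 q}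

/-- The spare events of distinct types are disjoint, since each makes its own type strictly first,
and they are disjoint from `noArrival`. So at most one indicator is nonzero. -/
lemma ncard_matched_le [Fintype I] (A : OnlineAlgorithm I (Fin 2) Ω)
    (G : MatchingInstance I (Fin 2)) {w : Ω × (I × ℕ → ℝ)} (hw : ∀ q, 0 < w.2 q) :
    ((A.matched G w.1 w.2).ncard : ℝ) ≤ 2 - 2 * (noArrival I Ω).indicator 1 w -
      ∑ i, (A.spareEvent G i).indicator 1 w := by
  by_cases hF : w ∈ noArrival I Ω
  · rw [A.matched_eq_empty G w.1 hw hF, Set.indicator_of_mem hF, sum_eq_zero]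
    · simp
    · intro i _
      exact Set.indicator_of_notMem (fun h => (hF i).not_ge h.1.2) _
  rw [Set.indicator_of_notMem hF]
  by_cases hE : ∃ i, w ∈ A.spareEvent G i
  · obtain ⟨i, hi⟩ := hE
    have hsum : ∑ i, (A.spareEvent G i).indicator (1 : Ω × (I × ℕ → ℝ) → ℝ) w = 1 := by
      rw [sum_eq_single i, Set.indicator_of_mem hi, Pi.one_apply]
      · intro i' _ hne
        refine Set.indicator_of_notMem (fun hi' => ?_) _
        have h1 := lt_of_gapThreshold_lt hne hi.1.2 (hi.2 _ (mem_otherGaps_of_ne hne))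
        have h2 := lt_of_gapThreshold_lt hne.symm hi'.1.2 (hi'.2 _ (mem_otherGaps_of_ne hne.symm))
        exact lt_asymm h1 h2
      · simp
    have hspared := A.notMem_matched G w.1 hw hi.1.2 hi.2 (A.decide_ne_spared i _ _)
    have hcard : (A.matched G w.1 w.2).ncard < (Set.univ : Set (Fin 2)).ncard :=
      Set.ncard_lt_ncard (Set.ssubset_univ_iff.2 fun h => hspared (h ▸ Set.mem_univ _))
    rw [Set.ncard_univ, Nat.card_eq_fintype_card, Fintype.card_fin] at hcard
    have : ((A.matched G w.1 w.2).ncard : ℝ) ≤ 1 := by exact_mod_cast Nat.le_of_lt_succ hcard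
    rw [hsum]
    linarith
  · push Not at hE
    rw [sum_eq_zero fun i _ => Set.indicator_of_notMem (hE i) _]
    have hcard := Set.ncard_le_card (A.matched G w.1 w.2)
    have : ((A.matched G w.1 w.2).ncard : ℝ) ≤ 2 := by
      exact_mod_cast hcard.trans (by simp)
    linarith

lemma measurable_gapThreshold_spared (A : OnlineAlgorithm I (Fin 2) Ω)
    (G : MatchingInstance I (Fin 2)) (i : I) (q : I × ℕ) :
    Measurable fun z : Ω × ℝ => gapThreshold G (A.spared i z) i q z.2 := by
  unfold gapThreshold
  refine Measurable.sub (Measurable.ite ?_ measurable_const measurable_snd) ?_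
  · exact A.measurable_spared i (MeasurableSet.of_discrete (s := {u | u ∈ G.nbr q.1}))
  · split_ifs
    · exact measurable_snd
    · exact measurable_const

lemma measurableSet_spareEvent [Fintype I] (A : OnlineAlgorithm I (Fin 2) Ω)
    (G : MatchingInstance I (Fin 2)) (i : I) : MeasurableSet (A.spareEvent G i) := by
  have hm : Measurable fun w : Ω × (I × ℕ → ℝ) => w.2 (i, 0) := by fun_prop
  have h : MeasurableSet {w : Ω × (I × ℕ → ℝ) | ∀ q ∈ otherGaps i,
      gapThreshold G (A.spared i (w.1, w.2 (i, 0))) i q (w.2 (i, 0)) < w.2 q} := by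
    simp only [Set.ofPred_forall]
    exact MeasurableSet.iInter fun q => MeasurableSet.iInter fun _ => measurableSet_lt
      ((A.measurable_gapThreshold_spared G i q).comp (measurable_fst.prodMk hm)) (by fun_prop)
  exact (hm measurableSet_Icc).inter h

lemma prod_gapLaw_noArrival [Fintype I] (G : MatchingInstance I (Fin 2)) (ρ : Measure Ω)
    [IsProbabilityMeasure ρ] :
    (ρ.prod G.gapLaw) (noArrival I Ω) = ENNReal.ofReal (Real.exp (-∑ i, G.rate i)) := by
  have h : noArrival I Ω = Set.univ ×ˢ {g : I × ℕ → ℝ | ∀ q ∈ univ.image fun i : I => (i, 0),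
      (1 : ℝ) < g q} := by
    ext w
    simp [noArrival]
  rw [h, Measure.prod_prod, measure_univ, one_mul,
    G.gapLaw_forall_lt (θ := fun _ => 1) _ fun _ _ => zero_le_one,
    sum_image fun i _ i' _ h => congrArg Prod.fst h]
  simp

/-- By `hab` the exponent is the same for both values of `u`, so the integrand is free of the seed
and of the algorithm's choices. -/
lemma prod_gapLaw_spareEvent [Fintype I] (A : OnlineAlgorithm I (Fin 2) Ω)
    (G : MatchingInstance I (Fin 2)) (ρ : Measure Ω) [IsProbabilityMeasure ρ] (i : I) {a b : ℝ}
    (hab : ∀ u t, G.rate i * t + ∑ q ∈ otherGaps i, G.rate q.1 * gapThreshold G u i q t =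
      a + b * t) :
    (ρ.prod G.gapLaw) (A.spareEvent G i) =
      ∫⁻ t in Set.Icc 0 1, ENNReal.ofReal (G.rate i * Real.exp (-(a + b * t))) := by
  rw [Measure.prod_apply (A.measurableSet_spareEvent G i)]
  have h : ∀ r, G.gapLaw (Prod.mk r ⁻¹' A.spareEvent G i) =
      ∫⁻ t in Set.Icc 0 1, ENNReal.ofReal (G.rate i * Real.exp (-(a + b * t))) := by
    intro r
    refine (G.gapLaw_mem_and_forall_lt (p := (i, 0)) (T := otherGaps i) (by simp [otherGaps])
      measurableSet_Icc (fun t ht => ht.1)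
      (θ := fun q t => gapThreshold G (A.spared i (r, t)) i q t)
      (fun q => (A.measurable_gapThreshold_spared G i q).comp measurable_prodMk_left)
      fun q t ht => ?_).trans (lintegral_congr fun t => by rw [hab])
    have := ht.1
    have := ht.2
    unfold gapThreshold
    split_ifs <;> linarith
  simp [h]

lemma measureReal_spareEvent [Fintype I] (A : OnlineAlgorithm I (Fin 2) Ω)
    (G : MatchingInstance I (Fin 2)) (ρ : Measure Ω) [IsProbabilityMeasure ρ] (i : I) {a b : ℝ}
    (hb : b ≠ 0)
    (hab : ∀ u t, G.rate i * t + ∑ q ∈ otherGaps i, G.rate q.1 * gapThreshold G u i q t =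
      a + b * t) :
    (ρ.prod G.gapLaw).real (A.spareEvent G i) =
      G.rate i * ((Real.exp (-a) - Real.exp (-(a + b))) / b) := by
  have hc : Continuous fun t : ℝ => G.rate i * Real.exp (-(a + b * t)) := by fun_prop
  rw [measureReal_def, A.prod_gapLaw_spareEvent G ρ i hab, ← integral_eq_lintegral_of_nonneg_ae
    (.of_forall fun t => mul_nonneg (G.rate_pos i).le (Real.exp_pos _).le)
    hc.aestronglyMeasurable, integral_Icc_eq_integral_Ioc,
    ← intervalIntegral.integral_of_le zero_le_one,
    intervalIntegral.integral_eq_sub_of_hasDerivAt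
      (f := fun t => -(G.rate i * Real.exp (-(a + b * t)) / b)) (fun t _ => ?_)
      (hc.intervalIntegrable _ _)]
  · simp only [mul_one, mul_zero, add_zero]
    ring
  · have h := ((((hasDerivAt_id t).const_mul b).const_add a).neg.exp.const_mul (G.rate i)).div_const
      b |>.neg
    refine h.congr_deriv ?_
    simp only [id, Pi.neg_apply]
    field_simp

lemma expectedSize_le [Fintype I] (A : OnlineAlgorithm I (Fin 2) Ω)
    (G : MatchingInstance I (Fin 2)) (ρ : Measure Ω) [IsProbabilityMeasure ρ] :
    A.expectedSize G ρ ≤ 2 - 2 * (ρ.prod G.gapLaw).real (noArrival I Ω) -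
      ∑ i, (ρ.prod G.gapLaw).real (A.spareEvent G i) := by
  have hF : Integrable ((noArrival I Ω).indicator (1 : Ω × (I × ℕ → ℝ) → ℝ))
      (ρ.prod G.gapLaw) :=
    (integrable_const (1 : ℝ)).indicator measurableSet_noArrival
  have hE : ∀ i, Integrable ((A.spareEvent G i).indicator (1 : Ω × (I × ℕ → ℝ) → ℝ))
      (ρ.prod G.gapLaw) := fun i =>
    (integrable_const (1 : ℝ)).indicator (A.measurableSet_spareEvent G i)
  have hF2 : Integrable (fun w => 2 - 2 * (noArrival I Ω).indicator (1 : Ω × (I × ℕ → ℝ) → ℝ) w)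
      (ρ.prod G.gapLaw) := (integrable_const (2 : ℝ)).sub (hF.const_mul 2)
  have hsum := integrable_finsetSum univ fun i _ => hE i
  have hpos : ∀ᵐ w ∂ρ.prod G.gapLaw, ∀ q, 0 < w.2 q :=
    Measure.quasiMeasurePreserving_snd.ae G.ae_gap_pos
  calc A.expectedSize G ρ
      ≤ ∫ w, 2 - 2 * (noArrival I Ω).indicator 1 w - ∑ i, (A.spareEvent G i).indicator 1 w
          ∂ρ.prod G.gapLaw :=
        -- Only the upper bound has to be integrable here, so measurability of the matching size is
        -- not needed.
        integral_mono_of_nonneg (.of_forall fun _ => Nat.cast_nonneg _) (hF2.sub hsum)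
          (hpos.mono fun w hw => A.ncard_matched_le G hw)
    _ = _ := by
        rw [integral_sub hF2 hsum, integral_sub (integrable_const _) (hF.const_mul 2),
          integral_const_mul, integral_finsetSum _ fun i _ => hE i,
          integral_indicator_one measurableSet_noArrival]
        simp [integral_indicator_one (A.measurableSet_spareEvent G _)]

end OnlineAlgorithm

end TwoOfflineVertices

/-! ### The hard instance. -/

lemma one_sub_log_two_pos : 0 < 1 - Real.log 2 := by
  linarith [Real.log_two_lt_d9]

/-- Two types of rate `1 - ln 2` with one adjacent offline vertex each, and one type of rate
`2 ln 2` that is adjacent to both offline vertices. -/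
def hardInstance : MatchingInstance (Fin 3) (Fin 2) where
  rate := ![1 - Real.log 2, 1 - Real.log 2, 2 * Real.log 2]
  rate_pos := by
    have := one_sub_log_two_pos
    have := Real.log_pos one_lt_two
    intro i
    fin_cases i <;> simp <;> linarith
  nbr := ![{0}, {1}, {0, 1}]

lemma adjacent_zero_hardInstance :
    ({i | 0 ∈ hardInstance.nbr i} : Finset (Fin 3)) = {0, 2} := by
  ext i
  rw [mem_filter_univ]
  fin_cases i <;> simp [hardInstance]

lemma adjacent_one_hardInstance :
    ({i | 1 ∈ hardInstance.nbr i} : Finset (Fin 3)) = {1, 2} := by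
  ext i
  rw [mem_filter_univ]
  fin_cases i <;> simp [hardInstance]

lemma isGreatest_jlValues_hardInstance : IsGreatest hardInstance.jlValues 2 := by
  have h0 := one_sub_log_two_pos
  have h1 := Real.log_pos one_lt_two
  constructor
  -- Each type spends its full rate, the third one split evenly. All constraints on `J` are tight:
  -- the half-rate terms are `1 - ln 2` for the private type and `0` for the shared one.
  · refine ⟨fun i _ => ![1 - Real.log 2, 1 - Real.log 2, Real.log 2] i, ?_, ?_⟩
    · constructor
      · intro i j _
        fin_cases i <;> simp <;> linarith
      · intro i
        fin_cases i <;> simp [hardInstance, two_mul]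
      · rw [Fin.forall_fin_two, adjacent_zero_hardInstance, adjacent_one_hardInstance]
        simp
      · have h2 : max (2 * (1 - Real.log 2) - (1 - Real.log 2)) 0 = 1 - Real.log 2 := by
          rw [max_eq_left] <;> linarith
        rw [Fin.forall_fin_two, adjacent_zero_hardInstance, adjacent_one_hardInstance]
        simp [hardInstance, h2]
    · simp [hardInstance, Fin.sum_univ_three]
      ring
  · rintro v ⟨x, hx, rfl⟩
    -- The two offline constraints add up to the objective.
    have h2 := hx.offline 0
    have h3 := hx.offline 1
    rw [adjacent_zero_hardInstance] at h2
    rw [adjacent_one_hardInstance] at h3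
    simp [hardInstance, Fin.sum_univ_three] at h2 h3 ⊢
    linarith

/-- The left side sums `rate * 1` over the types adjacent to `u` and `rate * t` over the others, the
term `rate i * t` cancelling the shift in the second gap of `i`. The adjacent rates total `1 + ln 2`
for either `u`, and the one remaining type has rate `1 - ln 2`. -/
lemma hardInstance_exponent (i : Fin 3) (u : Fin 2) (t : ℝ) :
    hardInstance.rate i * t +
      ∑ q ∈ otherGaps i, hardInstance.rate q.1 * gapThreshold hardInstance u i q t =
      (1 + Real.log 2) + (1 - Real.log 2) * t := by
  have h : ∀ i : Fin 3, otherGaps i =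
      ![{(0, 1), (1, 0), (2, 0)}, {(1, 1), (0, 0), (2, 0)}, {(2, 1), (0, 0), (1, 0)}] i := by
    decide
  rw [h]
  fin_cases i <;> fin_cases u <;> simp [gapThreshold, hardInstance] <;> ring

lemma expectedSize_hardInstance_le {Ω : Type*} [MeasurableSpace Ω] (ρ : Measure Ω)
    [IsProbabilityMeasure ρ] (A : OnlineAlgorithm (Fin 3) (Fin 2) Ω) :
    A.expectedSize hardInstance ρ ≤ 2 * hardnessRatio := by
  have h0 := one_sub_log_two_pos.ne'
  have hrate : ∑ i, hardInstance.rate i = 2 := by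
    simp [hardInstance, Fin.sum_univ_three]
    ring
  have h1 : Real.exp (-2) = (Real.exp 1 ^ 2)⁻¹ := by
    rw [Real.exp_neg, ← Real.exp_nat_mul]
    norm_num
  have h2 : Real.exp (-(1 + Real.log 2)) = 1 / (2 * Real.exp 1) := by
    rw [Real.exp_neg, Real.exp_add, Real.exp_log two_pos, one_div, mul_comm]
  refine (A.expectedSize_le hardInstance ρ).trans_eq ?_
  simp only [A.measureReal_spareEvent hardInstance ρ _ h0 (hardInstance_exponent _)]
  rw [← sum_mul, measureReal_def, OnlineAlgorithm.prod_gapLaw_noArrival, hrate,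
    ENNReal.toReal_ofReal (Real.exp_pos _).le, h2,
    show 1 + Real.log 2 + (1 - Real.log 2) = 2 by ring, h1, hardnessRatio]
  field_simp
  ring

/-! ### Numerical value of the ratio. -/

lemma abs_hardnessRatio_sub_lt : |hardnessRatio - 0.706| < 0.0005 := by
  have hl := Real.log_two_gt_d9
  have hl' := Real.log_two_lt_d9
  have he := Real.exp_one_gt_d9
  have he' := Real.exp_one_lt_d9
  have h0 := one_sub_log_two_pos
  have hx : (0.36787 : ℝ) < 1 / Real.exp 1 := by
    rw [lt_div_iff₀ (Real.exp_pos 1)]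
    linarith
  have hx' : 1 / Real.exp 1 < (0.36789 : ℝ) := by
    rw [div_lt_iff₀ (Real.exp_pos 1)]
    linarith
  have h : hardnessRatio = 1 - ((1 / Real.exp 1) / 2 - Real.log 2 * (1 / Real.exp 1) ^ 2) /
      (1 - Real.log 2) := by
    rw [hardnessRatio]
    field_simp
  set x := 1 / Real.exp 1
  have hsq : (0.36787 : ℝ) ^ 2 < x ^ 2 := by gcongr
  have hsq' : x ^ 2 < (0.36789 : ℝ) ^ 2 := by gcongr
  have hu : Real.log 2 * x ^ 2 ≤ 0.6931471808 * 0.36789 ^ 2 := by gcongr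
  have hv : 0.6931471803 * 0.36787 ^ 2 ≤ Real.log 2 * x ^ 2 := by gcongr
  -- The subtracted fraction is about `0.2937`; the bounds `0.2936` and `0.2944` lie within `0.0005`
  -- of `1 - 0.706`.
  have h1 : (x / 2 - Real.log 2 * x ^ 2) / (1 - Real.log 2) < 0.2944 := by
    rw [div_lt_iff₀ h0]
    linarith
  have h2 : 0.2936 < (x / 2 - Real.log 2 * x ^ 2) / (1 - Real.log 2) := by
    rw [lt_div_iff₀ h0]
    linarith
  rw [h, abs_lt]
  constructor <;> linarith

end StochasticMatching

end

theorem mainTheorem6 :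
    (∃ G : StochasticMatching.MatchingInstance (Fin 3) (Fin 2), ∃ JL : ℝ,
      IsGreatest G.jlValues JL ∧ 0 < JL ∧
      ∀ (Ω : Type*) [MeasurableSpace Ω] (ρ : Measure Ω) [IsProbabilityMeasure ρ]
        (A : StochasticMatching.OnlineAlgorithm (Fin 3) (Fin 2) Ω),
        A.expectedSize G ρ / JL ≤ StochasticMatching.hardnessRatio) ∧
    |StochasticMatching.hardnessRatio - 0.706| < 0.0005 := by
  refine ⟨⟨StochasticMatching.hardInstance, 2,
    StochasticMatching.isGreatest_jlValues_hardInstance, two_pos, fun Ω _ ρ _ A => ?_⟩,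
    StochasticMatching.abs_hardnessRatio_sub_lt⟩
  rw [div_le_iff₀ two_pos, mul_comm]
  exact StochasticMatching.expectedSize_hardInstance_le ρ A
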